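/- Let $R$ be an associative ring with identity and let $n\ge 1$ be an integer. A left $R$-module $M$ is called $n$-presented if there is an exact sequence of left $R$-modules $F_n\to F_{n-1}\to\cdots\to F_0\to M\to 0$ in which each $F_i$ is finitely generated and free. Let $\mathscr{X}$ be a class of left $R$-modules such that the subclass $\mathscr{X}_n$ of all $n$-presented modules in $\mathscr{X}$ is not empty. The ring $R$ is called left $n$-$\mathscr{X}$-coherent if $\mathscr{X}_n$ is not empty and every module in $\mathscr{X}_n$ is $(n+1)$-presented. A right $R$-module $M$ is called $n$-$\mathscr{X}$-flat if $\mathrm{Tor}^R_n(M,N)=0$ for every $N\in\mathscr{X}_n$. An $n$-$\mathscr{X}$-flat preenvelope of a right $R$-module $M$ is a homomorphism $\varphi\colon M\to F$ of right $R$-modules with $F$ an $n$-$\mathscr{X}$-flat right $R$-module such that for every homomorphism $\varphi'\colon M\to F'$ with $F'$ an $n$-$\mathscr{X}$-flat right $R$-module there is a homomorphism $f\colon F\to F'$ with $\varphi'=f\varphi$. Then $R$ is left $n$-$\mathscr{X}$-coherent if and only if every right $R$-module has an $n$-$\mathscr{X}$-flat preenvelope. -/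

import Mathlib

universe u

open CategoryTheory CategoryTheory.Limits
open scoped TensorProduct

namespace RelCoherent

noncomputable section

section Presented

variable (R : Type u) [Ring R]

/-- `M` is `n`-presented: there is an exact sequence of left `R`-modules
`F_n → F_{n-1} → ⋯ → F_0 → M → 0` with each `F_i = R ^ (r i)` finitely generated and free.
(The ranks `r i` with `i > n` and the maps `d i : F_{i+1} → F_i` with `i ≥ n` are unconstrained
and play no role.) -/
def IsNPresented (n : ℕ) (M : Type u) [AddCommGroup M] [Module R M] : Prop :=
  ∃ (r : ℕ → ℕ) (d : ∀ i : ℕ, (Fin (r (i + 1)) → R) →ₗ[R] (Fin (r i) → R))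
    (ε : (Fin (r 0) → R) →ₗ[R] M),
    Function.Surjective ε ∧
    (0 < n → Function.Exact (d 0) ε) ∧
    ∀ i : ℕ, i + 1 < n → Function.Exact (d (i + 1)) (d i)

variable {R}

/-- The subclass `𝒳_n` of the `n`-presented modules of a class `𝒳` of left `R`-modules. -/
def nPresentedPart (𝒳 : ObjectProperty (ModuleCat.{u} R)) (n : ℕ) :
    ObjectProperty (ModuleCat.{u} R) :=
  fun M => 𝒳 M ∧ IsNPresented R n M

/-- `R` is left `n`-`𝒳`-coherent: `𝒳_n` is not empty, and every module in `𝒳_n` is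
`(n + 1)`-presented. -/
def IsLeftCoherent (n : ℕ) (𝒳 : ObjectProperty (ModuleCat.{u} R)) : Prop :=
  (∃ N, nPresentedPart 𝒳 n N) ∧
    ∀ N, nPresentedPart 𝒳 n N → IsNPresented R (n + 1) N

end Presented

section Tensor

variable {R : Type u} [Ring R]

/-- The subgroup of `M ⊗_ℤ N` generated by the elements `(m r) ⊗ x - m ⊗ (r x)`, where `M` is a
right `R`-module (a left module over the opposite ring) and `N` is a left `R`-module. -/
def balancedRel (M : ModuleCat.{u} Rᵐᵒᵖ) (N : ModuleCat.{u} R) : Submodule ℤ (M ⊗[ℤ] N) :=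
  Submodule.span ℤ
    {t | ∃ (m : M) (r : R) (x : N), t = (MulOpposite.op r • m) ⊗ₜ[ℤ] x - m ⊗ₜ[ℤ] (r • x)}

/-- The tensor product `M ⊗_R N` of a right and a left `R`-module, an abelian group. -/
abbrev BalancedTensor (M : ModuleCat.{u} Rᵐᵒᵖ) (N : ModuleCat.{u} R) : Type u :=
  (M ⊗[ℤ] N) ⧸ balancedRel M N

/-- The pure tensor `m ⊗ x` in `M ⊗_R N`. -/
def BalancedTensor.tmul {M : ModuleCat.{u} Rᵐᵒᵖ} {N : ModuleCat.{u} R} (m : M) (x : N) :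
    BalancedTensor M N :=
  (balancedRel M N).mkQ (m ⊗ₜ[ℤ] x)

theorem BalancedTensor.hom_ext {M : ModuleCat.{u} Rᵐᵒᵖ} {N : ModuleCat.{u} R}
    {A : Type u} [AddCommGroup A] {f g : BalancedTensor M N →ₗ[ℤ] A}
    (h : ∀ (m : M) (x : N), f (BalancedTensor.tmul m x) = g (BalancedTensor.tmul m x)) :
    f = g :=
  Submodule.linearMap_qext _ (TensorProduct.ext' h)

theorem balancedRel_le_comap (M : ModuleCat.{u} Rᵐᵒᵖ) {N N' : ModuleCat.{u} R} (f : N ⟶ N') :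
    balancedRel M N ≤ (balancedRel M N').comap
      (LinearMap.lTensor M f.hom.toAddMonoidHom.toIntLinearMap) := by
  refine Submodule.span_le.2 ?_
  rintro _ ⟨m, r, x, rfl⟩
  refine Submodule.subset_span ⟨m, r, f.hom x, ?_⟩
  simp

/-- The map `M ⊗_R f : M ⊗_R N → M ⊗_R N'`. -/
def BalancedTensor.map (M : ModuleCat.{u} Rᵐᵒᵖ) {N N' : ModuleCat.{u} R} (f : N ⟶ N') :
    BalancedTensor M N →ₗ[ℤ] BalancedTensor M N' :=
  (balancedRel M N).mapQ (balancedRel M N')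
    (LinearMap.lTensor M f.hom.toAddMonoidHom.toIntLinearMap) (balancedRel_le_comap M f)

theorem BalancedTensor.map_tmul (M : ModuleCat.{u} Rᵐᵒᵖ) {N N' : ModuleCat.{u} R} (f : N ⟶ N')
    (m : M) (x : N) :
    BalancedTensor.map M f (BalancedTensor.tmul m x) = BalancedTensor.tmul m (f.hom x) :=
  rfl

/-- The functor `M ⊗_R -` from left `R`-modules to abelian groups. -/
def tensorFunctor (M : ModuleCat.{u} Rᵐᵒᵖ) : ModuleCat.{u} R ⥤ ModuleCat.{u} ℤ where
  obj N := ModuleCat.of ℤ (BalancedTensor M N)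
  map f := ModuleCat.ofHom (BalancedTensor.map M f)
  map_id N := by
    ext : 1
    exact BalancedTensor.hom_ext fun m x => rfl
  map_comp f g := by
    ext : 1
    exact BalancedTensor.hom_ext fun m x => rfl

instance (M : ModuleCat.{u} Rᵐᵒᵖ) : (tensorFunctor M).Additive where
  map_add {N N'} f g := by
    ext : 1
    refine BalancedTensor.hom_ext fun m x => ?_
    change BalancedTensor.tmul m (f.hom x + g.hom x) =
      BalancedTensor.tmul m (f.hom x) + BalancedTensor.tmul m (g.hom x)
    simp only [BalancedTensor.tmul, TensorProduct.tmul_add, map_add]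

/-- `Tor_n^R(M, N)`, the value at `N` of the `n`-th left derived functor of `M ⊗_R -`. -/
def TorGroup (n : ℕ) (M : ModuleCat.{u} Rᵐᵒᵖ) (N : ModuleCat.{u} R) : ModuleCat.{u} ℤ :=
  ((tensorFunctor M).leftDerived n).obj N

/-- The right `R`-module `M` is `n`-`𝒳`-flat: `Tor_n^R(M, N) = 0` for every `N` in `𝒳_n`. -/
def IsFlatRel (n : ℕ) (𝒳 : ObjectProperty (ModuleCat.{u} R)) :
    ObjectProperty (ModuleCat.{u} Rᵐᵒᵖ) :=
  fun M => ∀ N, nPresentedPart 𝒳 n N → IsZero (TorGroup n M N)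

end Tensor

section Preenvelope

variable {S : Type u} [Ring S]

/-- `φ : M → F` is an `ℱ`-preenvelope of `M`: `F` lies in `ℱ`, and every homomorphism from `M`
to a module in `ℱ` factors through `φ`. -/
def IsPreenvelope (ℱ : ObjectProperty (ModuleCat.{u} S)) {M F : ModuleCat.{u} S}
    (φ : M ⟶ F) : Prop :=
  ℱ F ∧ ∀ (F' : ModuleCat.{u} S) (φ' : M ⟶ F'), ℱ F' → ∃ f : F ⟶ F', φ' = φ ≫ f

/-- `M` has an `ℱ`-preenvelope. -/
def HasPreenvelope (ℱ : ObjectProperty (ModuleCat.{u} S)) (M : ModuleCat.{u} S) : Prop :=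
  ∃ (F : ModuleCat.{u} S) (φ : M ⟶ F), IsPreenvelope ℱ φ

end Preenvelope

end

end RelCoherent

/-! Write `n + 1` for the given integer and let `d n : F_{n+1} → F_n` be the last map of a finite
free presentation of `N`. Tensoring with finite free modules gives powers of `M`, so `Tor_{n+1}(M,
N) = 0` says that every solution in `M` of the finite linear system with matrix `d n` is an
`M`-combination of solutions in `R` (`isZero_torGroup_succ_iff`).

Given preenvelopes, let `K = ker (d n)` and take one of `R ^ K`, say `R ^ K → F`. The coordinate
functions on `K` form a solution in `R ^ K`, whose image in `F` involves only finitely many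
solutions in `R`. As `R` is relatively flat, the projections `R ^ K → R` factor through `F`, so
these solutions generate `K` (`ker_fg_of_preenvelope`).

Conversely, coherence supplies finitely many generators of `K` that serve all modules at once, so
relative flatness is solvability of a set of systems with fixed generators
(`IsLeftCoherent.exists_systems`). Such a class is closed under products, and every map from `M`
into a member factors through a member built from terms over `M`. These form a set, and their
product is a preenvelope (`hasPreenvelope_of_solvedIn`). -/

namespace RelCoherent

/-! ### Spliced projective resolutions and dimension shifting. -/

section DimensionShift

universe v w v' w'

variable {C : Type w} [Category.{v} C] [Abelian C] {D : Type w'} [Category.{v'} D] [Abelian D]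

/-- The augmentation `P_0 → Z` of a projective resolution. -/
noncomputable def augmentation {Z : C} (P : ProjectiveResolution Z) : P.complex.X 0 ⟶ Z :=
  P.π.f 0

instance {Z : C} (P : ProjectiveResolution Z) : Epi (augmentation P) :=
  inferInstanceAs (Epi (P.π.f 0))

theorem d_comp_augmentation {Z : C} (P : ProjectiveResolution Z) :
    P.complex.d 1 0 ≫ augmentation P = 0 :=
  P.complex_d_comp_π_f_zero

theorem exact_augmentation {Z : C} (P : ProjectiveResolution Z) :
    (ShortComplex.mk _ _ (d_comp_augmentation P)).Exact :=
  P.exact₀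

/-- A chain complex of projectives that is exact in positive degrees is a projective resolution
of the cokernel of its first differential. -/
noncomputable def resolutionOfExact {Z : C} (K : ChainComplex C ℕ) (hK : ∀ n, Projective (K.X n))
    (p : K.X 0 ⟶ Z) (w : K.d 1 0 ≫ p = 0) (h₀ : (ShortComplex.mk _ _ w).Exact) (hp : Epi p)
    (h : ∀ n, K.ExactAt (n + 1)) : ProjectiveResolution Z where
  complex := K
  projective := hK
  π := (ChainComplex.toSingle₀Equiv _ _).symm ⟨p, w⟩
  quasiIso := by
    refine ⟨fun n => ?_⟩
    cases n with
    | zero =>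
      rw [ChainComplex.quasiIsoAt₀_iff, ShortComplex.quasiIso_iff_of_zeros']
      · have e : ((ChainComplex.toSingle₀Equiv K Z).symm ⟨p, w⟩).f 0 = p :=
          ChainComplex.toSingle₀Equiv_symm_apply_f_zero p w
        refine (ShortComplex.exact_and_epi_g_iff_of_iso (S₁ := ShortComplex.mk _ _ w)
          ?_).1 ⟨h₀, hp⟩
        refine ShortComplex.isoMk (Iso.refl _) (Iso.refl _) (Iso.refl _) ?_ ?_
        · exact (Category.id_comp _).trans (Category.comp_id _).symm
        · exact (Category.id_comp _).trans (e.trans (Category.comp_id _).symm)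
      · exact K.shape _ _ (by simp)
      all_goals rfl
    | succ n =>
      rw [quasiIsoAt_iff_exactAt']
      · exact h n
      · apply ChainComplex.exactAt_succ_single_obj

/-- Splicing a projective resolution of `K` with a short exact sequence `0 → K → P → Z → 0`,
`P` projective, yields a projective resolution of `Z`. -/
noncomputable def spliceResolution {S : ShortComplex C} (hS : S.ShortExact) [Projective S.X₂]
    (Q : ProjectiveResolution S.X₁) : ProjectiveResolution S.X₃ :=
  resolutionOfExact
    (Q.complex.augment (augmentation Q ≫ S.f) (by
      rw [← Category.assoc, d_comp_augmentation, zero_comp]))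
    (fun n => by
      cases n with
      | zero => exact (inferInstance : Projective S.X₂)
      | succ n => exact Q.projective n)
    S.g (by
      have : (augmentation Q ≫ S.f) ≫ S.g = 0 := by rw [Category.assoc, S.zero, comp_zero]
      exact this)
    (by
      have w : (augmentation Q ≫ S.f) ≫ S.g = 0 := by rw [Category.assoc, S.zero, comp_zero]
      have : (ShortComplex.mk _ _ w).Exact := by
        let φ : ShortComplex.mk _ _ w ⟶ S :=
          { τ₁ := augmentation Q, τ₂ := 𝟙 _, τ₃ := 𝟙 _ }
        have : Epi φ.τ₁ := inferInstanceAs (Epi (augmentation Q))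
        have : IsIso φ.τ₂ := inferInstanceAs (IsIso (𝟙 _))
        have : Mono φ.τ₃ := inferInstanceAs (Mono (𝟙 _))
        exact (ShortComplex.exact_iff_of_epi_of_isIso_of_mono φ).2 hS.exact
      exact this)
    hS.epi_g
    (fun n => by
      rw [HomologicalComplex.exactAt_iff' _ (n + 1 + 1) (n + 1) n (by simp) (by simp)]
      cases n with
      | zero =>
        have w : Q.complex.d 1 0 ≫ augmentation Q ≫ S.f = 0 := by
          rw [← Category.assoc, d_comp_augmentation, zero_comp]
        have : (ShortComplex.mk _ _ w).Exact := by
          let φ : ShortComplex.mk _ _ (d_comp_augmentation Q) ⟶ ShortComplex.mk _ _ w :=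
            { τ₁ := 𝟙 _, τ₂ := 𝟙 _, τ₃ := S.f }
          have : Epi φ.τ₁ := inferInstanceAs (Epi (𝟙 _))
          have : IsIso φ.τ₂ := inferInstanceAs (IsIso (𝟙 _))
          have : Mono φ.τ₃ := hS.mono_f
          exact (ShortComplex.exact_iff_of_epi_of_isIso_of_mono φ).1 (exact_augmentation Q)
        exact this
      | succ n => exact Q.exact_succ n)

theorem isZero_leftDerived_succ_iff [HasProjectiveResolutions C] (F : C ⥤ D) [F.Additive]
    {Z : C} (P : ProjectiveResolution Z) (n : ℕ) :
    IsZero ((F.leftDerived (n + 1)).obj Z) ↔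
      (ShortComplex.mk (F.map (P.complex.d (n + 2) (n + 1))) (F.map (P.complex.d (n + 1) n))
        (by rw [← F.map_comp, P.complex.d_comp_d, F.map_zero])).Exact := by
  rw [(P.isoLeftDerivedObj F (n + 1)).isZero_iff]
  refine (HomologicalComplex.exactAt_iff_isZero_homology
    ((F.mapHomologicalComplex (ComplexShape.down ℕ)).obj P.complex) (n + 1)).symm.trans ?_
  rw [HomologicalComplex.exactAt_iff' _ (n + 2) (n + 1) n (by simp) (by simp)]
  rfl

/-- In positive degrees the spliced resolution is that of `S.X₁` shifted by one, and the degrees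
involved here never reach `S.X₂`. -/
theorem isZero_leftDerived_shift [HasProjectiveResolutions C] (F : C ⥤ D) [F.Additive]
    {S : ShortComplex C} (hS : S.ShortExact) [Projective S.X₂] (n : ℕ) :
    IsZero ((F.leftDerived (n + 2)).obj S.X₃) ↔ IsZero ((F.leftDerived (n + 1)).obj S.X₁) := by
  let Q := projectiveResolution S.X₁
  rw [isZero_leftDerived_succ_iff F (spliceResolution hS Q),
    isZero_leftDerived_succ_iff F Q]
  rfl

end DimensionShift

/-! ### Vanishing of Tor as a condition on linear systems. -/

section TensorCoordinates

variable {R : Type u} [Ring R]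

theorem BalancedTensor.tmul_add_right {M : ModuleCat.{u} Rᵐᵒᵖ} {N : ModuleCat.{u} R}
    (a : M) (v w : N) : tmul a (v + w) = tmul a v + tmul a w := by
  simp only [tmul, TensorProduct.tmul_add, map_add]

theorem BalancedTensor.smul_tmul {M : ModuleCat.{u} Rᵐᵒᵖ} {N : ModuleCat.{u} R}
    (a : M) (r : R) (v : N) : tmul (MulOpposite.op r • a) v = tmul a (r • v) := by
  rw [tmul, tmul, ← sub_eq_zero, ← map_sub, Submodule.mkQ_apply, Submodule.Quotient.mk_eq_zero]
  exact Submodule.subset_span ⟨a, r, v, rfl⟩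

theorem BalancedTensor.exists_sum_tmul {M : ModuleCat.{u} Rᵐᵒᵖ} {N : ModuleCat.{u} R}
    (t : BalancedTensor M N) :
    ∃ (k : ℕ) (y : Fin k → M) (l : Fin k → N), t = ∑ j, tmul (y j) (l j) := by
  obtain ⟨t, rfl⟩ := (balancedRel M N).mkQ_surjective t
  obtain ⟨k, y, l, rfl⟩ := TensorProduct.exists_sum_tmul_eq t
  exact ⟨k, y, l, map_sum _ _ _⟩

/-- The coordinates `M ⊗_R R ^ m → M ^ m`. -/
noncomputable def tensorCoord (M : ModuleCat.{u} Rᵐᵒᵖ) (m : ℕ) :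
    BalancedTensor M (ModuleCat.of R (Fin m → R)) →ₗ[ℤ] (Fin m → M) :=
  (balancedRel M (ModuleCat.of R (Fin m → R))).liftQ
    (TensorProduct.lift (LinearMap.mk₂ ℤ (fun (a : M) (v : Fin m → R) (i : Fin m) =>
        MulOpposite.op (v i) • a)
      (fun a b v => by ext i; simp)
      (fun c a v => by ext i; exact smul_comm _ _ _)
      (fun a v w => by ext i; simp [add_smul])
      (fun c a v => by
        ext i
        change MulOpposite.op (c • v i) • a = c • MulOpposite.op (v i) • a
        rw [MulOpposite.op_smul, smul_assoc])))
    (by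
      refine Submodule.span_le.2 ?_
      rintro _ ⟨a, r, v, rfl⟩
      refine (map_sub _ _ _).trans (sub_eq_zero.2 ?_)
      ext i
      exact smul_smul _ _ _)

theorem tensorCoord_tmul (M : ModuleCat.{u} Rᵐᵒᵖ) {m : ℕ} (a : M) (v : Fin m → R) (i : Fin m) :
    tensorCoord M m (BalancedTensor.tmul (N := ModuleCat.of R (Fin m → R)) a v) i =
      MulOpposite.op (v i) • a :=
  rfl

/-- The map `x ↦ ∑ x_i ⊗ e_i` from `M ^ m` to `M ⊗_R R ^ m`. -/
noncomputable def tensorOfCoord (M : ModuleCat.{u} Rᵐᵒᵖ) (m : ℕ) :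
    (Fin m → M) →ₗ[ℤ] BalancedTensor M (ModuleCat.of R (Fin m → R)) :=
  ∑ i, (balancedRel M (ModuleCat.of R (Fin m → R))).mkQ ∘ₗ
    (TensorProduct.mk ℤ M (Fin m → R)).flip (Pi.single i 1) ∘ₗ LinearMap.proj i

theorem tensorOfCoord_apply (M : ModuleCat.{u} Rᵐᵒᵖ) {m : ℕ} (x : Fin m → M) :
    tensorOfCoord M m x =
      ∑ i, BalancedTensor.tmul (N := ModuleCat.of R (Fin m → R)) (x i) (Pi.single i (1 : R)) :=
  LinearMap.sum_apply _ _ _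

theorem tensorCoord_tensorOfCoord (M : ModuleCat.{u} Rᵐᵒᵖ) {m : ℕ} (x : Fin m → M) :
    tensorCoord M m (tensorOfCoord M m x) = x := by
  ext i
  rw [tensorOfCoord_apply, map_sum, Finset.sum_apply, Finset.sum_eq_single i]
  · simp [tensorCoord_tmul]
  · intro j _ hj
    simp [tensorCoord_tmul, Pi.single_eq_of_ne hj.symm]
  · simp

theorem tensorOfCoord_tensorCoord (M : ModuleCat.{u} Rᵐᵒᵖ) {m : ℕ}
    (t : BalancedTensor M (ModuleCat.of R (Fin m → R))) :
    tensorOfCoord M m (tensorCoord M m t) = t := by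
  suffices h : tensorOfCoord M m ∘ₗ tensorCoord M m = LinearMap.id from LinearMap.congr_fun h t
  refine BalancedTensor.hom_ext fun a (v : Fin m → R) => ?_
  let T : (Fin m → R) →+ BalancedTensor M (ModuleCat.of R (Fin m → R)) :=
    AddMonoidHom.mk' (fun v => BalancedTensor.tmul (N := ModuleCat.of R (Fin m → R)) a v)
      (BalancedTensor.tmul_add_right (N := ModuleCat.of R (Fin m → R)) a)
  have : T v = ∑ i, T (v i • Pi.single i 1) := by
    rw [← map_sum]; congr 1; exact pi_eq_sum_univ' v
  refine Eq.trans ?_ this.symm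
  refine (tensorOfCoord_apply M _).trans ?_
  exact Finset.sum_congr rfl fun i _ =>
    BalancedTensor.smul_tmul (N := ModuleCat.of R (Fin m → R)) _ _ _

theorem tensorCoord_injective (M : ModuleCat.{u} Rᵐᵒᵖ) (m : ℕ) :
    Function.Injective (tensorCoord M m) :=
  Function.LeftInverse.injective (tensorOfCoord_tensorCoord M)

theorem tensorCoord_map (M : ModuleCat.{u} Rᵐᵒᵖ) {m s : ℕ}
    (d : (Fin m → R) →ₗ[R] (Fin s → R))
    (t : BalancedTensor M (ModuleCat.of R (Fin m → R))) (j : Fin s) :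
    tensorCoord M s (BalancedTensor.map M (ModuleCat.ofHom d) t) j =
      ∑ i, MulOpposite.op (d (Pi.single i 1) j) • tensorCoord M m t i := by
  conv_lhs => rw [← tensorOfCoord_tensorCoord M t, tensorOfCoord_apply]
  rw [map_sum, map_sum, Finset.sum_apply]
  rfl

/-- Every solution in `M` of the homogeneous system with matrix `d` is a combination, with
coefficients in `M`, of solutions in `R`. -/
def SolutionsGenerated (M : ModuleCat.{u} Rᵐᵒᵖ) {m s : ℕ}
    (d : (Fin m → R) →ₗ[R] (Fin s → R)) : Prop :=
  ∀ x : Fin m → M, (∀ j, ∑ i, MulOpposite.op (d (Pi.single i 1) j) • x i = 0) →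
    ∃ (k : ℕ) (y : Fin k → M) (l : Fin k → Fin m → R), (∀ a, d (l a) = 0) ∧
      ∀ i, x i = ∑ a, MulOpposite.op (l a i) • y a

/-- Elements of `M ⊗ P` are finite sums of tensors `y ⊗ p`, and in coordinates `y ⊗ p` becomes the
solution `q p` of `d` with coefficient `y`. -/
theorem solutionsGenerated_iff (M : ModuleCat.{u} Rᵐᵒᵖ) {m s : ℕ}
    (d : (Fin m → R) →ₗ[R] (Fin s → R)) {P : ModuleCat.{u} R}
    (q : P ⟶ ModuleCat.of R (Fin m → R)) (hq : Function.Exact q.hom d) :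
    (∀ t, BalancedTensor.map M (ModuleCat.ofHom d) t = 0 → ∃ w, BalancedTensor.map M q w = t) ↔
      SolutionsGenerated M d := by
  constructor
  · intro h x hx
    obtain ⟨w, hw⟩ := h (tensorOfCoord M m x) (by
      refine tensorCoord_injective M s ?_
      ext j
      rw [tensorCoord_map, tensorCoord_tensorOfCoord, map_zero]
      exact hx j)
    obtain ⟨k, y, l, rfl⟩ := BalancedTensor.exists_sum_tmul w
    refine ⟨k, y, fun a => q.hom (l a), fun a => hq.apply_apply_eq_zero _, fun i => ?_⟩
    have := congrFun (congrArg (tensorCoord M m) hw) i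
    rw [tensorCoord_tensorOfCoord, map_sum, map_sum, Finset.sum_apply] at this
    exact this.symm
  · intro h t ht
    obtain ⟨k, y, l, hl, hx⟩ := h (tensorCoord M m t) (fun j => by
      rw [← tensorCoord_map, ht, map_zero, Pi.zero_apply])
    choose p hp using fun a => (hq (l a)).1 (hl a)
    refine ⟨∑ a, BalancedTensor.tmul (y a) (p a), tensorCoord_injective M m ?_⟩
    ext i
    rw [hx, map_sum, map_sum, Finset.sum_apply]
    refine Finset.sum_congr rfl fun a _ => ?_
    rw [BalancedTensor.map_tmul, hp, tensorCoord_tmul]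

/-- The augmentation of a spliced resolution is the given epimorphism. -/
theorem augmentation_spliceResolution {C : Type*} [Category C] [Abelian C] {S : ShortComplex C}
    (hS : S.ShortExact) [Projective S.X₂] (Q : ProjectiveResolution S.X₁) :
    augmentation (spliceResolution hS Q) = S.g :=
  ChainComplex.toSingle₀Equiv_symm_apply_f_zero _ _

theorem isZero_torGroup_one_iff (M : ModuleCat.{u} Rᵐᵒᵖ) (N : ModuleCat.{u} R) {m s : ℕ}
    (d : (Fin m → R) →ₗ[R] (Fin s → R)) (ε : (Fin s → R) →ₗ[R] N)
    (hε : Function.Surjective ε) (h : Function.Exact d ε) :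
    IsZero (TorGroup 1 M N) ↔ SolutionsGenerated M d := by
  let d' : (Fin m → R) →ₗ[R] LinearMap.ker ε := d.codRestrict _ h.apply_apply_eq_zero
  have hd' : Function.Surjective d' := by
    rintro ⟨v, hv⟩
    obtain ⟨w, rfl⟩ := (h v).1 hv
    exact ⟨w, rfl⟩
  have hS₁ := LinearMap.shortExact_shortComplexKer hε
  have hS₀ := LinearMap.shortExact_shortComplexKer hd'
  have : Projective (LinearMap.shortComplexKer ε).X₂ :=
    (IsProjective.iff_projective _).1 inferInstance
  have : Projective (LinearMap.shortComplexKer d').X₂ :=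
    (IsProjective.iff_projective _).1 inferInstance
  -- The kernel of `d` need not be finitely generated; arbitrary projectives suffice here, since
  -- only the two lowest terms need coordinates.
  let Q := projectiveResolution (LinearMap.shortComplexKer d').X₁
  let q := augmentation Q ≫ (LinearMap.shortComplexKer d').f
  have hq : Function.Exact q.hom d := by
    intro v
    constructor
    · intro hv
      obtain ⟨w, hw⟩ := (ModuleCat.epi_iff_surjective (augmentation Q)).1 inferInstance
        ⟨v, Subtype.ext hv⟩
      exact ⟨w, congrArg Subtype.val hw⟩
    · rintro ⟨w, rfl⟩
      exact congrArg Subtype.val ((augmentation Q).hom w).2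
  rw [← solutionsGenerated_iff M d q hq]
  refine (isZero_leftDerived_succ_iff (tensorFunctor M)
    (spliceResolution hS₁ (spliceResolution hS₀ Q)) 0).trans ?_
  rw [ShortComplex.moduleCat_exact_iff]
  have h₁ : (spliceResolution hS₁ (spliceResolution hS₀ Q)).complex.d 1 0 =
      ModuleCat.ofHom d :=
    congrArg (· ≫ (LinearMap.shortComplexKer ε).f) (augmentation_spliceResolution hS₀ Q)
  have h₂ (t) : (tensorFunctor M).map
      ((spliceResolution hS₁ (spliceResolution hS₀ Q)).complex.d 1 0) t =
      BalancedTensor.map M (ModuleCat.ofHom d) t := by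
    rw [h₁]; rfl
  exact forall_congr' fun t => imp_congr (by rw [← h₂]; rfl) Iff.rfl

/-- Passing from `N` to `ker ε` drops the first term of the presentation and lowers the degree of
Tor by one. -/
theorem isZero_torGroup_succ_iff (M : ModuleCat.{u} Rᵐᵒᵖ) (n : ℕ) (N : ModuleCat.{u} R)
    (r : ℕ → ℕ) (d : ∀ i : ℕ, (Fin (r (i + 1)) → R) →ₗ[R] (Fin (r i) → R))
    (ε : (Fin (r 0) → R) →ₗ[R] N) (hε : Function.Surjective ε) (h₀ : Function.Exact (d 0) ε)
    (h : ∀ i < n, Function.Exact (d (i + 1)) (d i)) :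
    IsZero (TorGroup (n + 1) M N) ↔ SolutionsGenerated M (d n) := by
  induction n generalizing N r with
  | zero => exact isZero_torGroup_one_iff M N (d 0) ε hε h₀
  | succ n ih =>
    have hS := LinearMap.shortExact_shortComplexKer hε
    have : Projective (LinearMap.shortComplexKer ε).X₂ :=
      (IsProjective.iff_projective _).1 inferInstance
    refine (isZero_leftDerived_shift (tensorFunctor M) hS n).trans ?_
    refine ih (ModuleCat.of R (LinearMap.ker ε)) (fun i => r (i + 1)) (fun i => d (i + 1))
      ((d 0).codRestrict _ h₀.apply_apply_eq_zero) ?_ ?_ fun i hi => h (i + 1) (by omega)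
    · rintro ⟨v, hv⟩
      obtain ⟨w, rfl⟩ := (h₀ v).1 hv
      exact ⟨w, rfl⟩
    · intro v
      exact Subtype.ext_iff.trans (h 0 (by omega) v)

end TensorCoordinates

/-! ### Finite generation of the last syzygy. -/

section Coherence

variable {R : Type u} [Ring R]

theorem isNPresented_succ_of_ker {M : Type u} [AddCommGroup M] [Module R M] {n s : ℕ}
    (ε : (Fin s → R) →ₗ[R] M) (hε : Function.Surjective ε)
    (h : IsNPresented R (n + 1) (LinearMap.ker ε)) : IsNPresented R (n + 2) M := by
  obtain ⟨r, d, π, hπ, h₀, h⟩ := h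
  refine ⟨fun | 0 => s | i + 1 => r i, fun | 0 => (LinearMap.ker ε).subtype ∘ₗ π | i + 1 => d i,
    ε, hε, fun _ => ?_, fun i hi => ?_⟩
  · intro v
    constructor
    · intro hv
      obtain ⟨w, hw⟩ := hπ ⟨v, hv⟩
      exact ⟨w, congrArg Subtype.val hw⟩
    · rintro ⟨w, rfl⟩
      exact (π w).2
  · cases i with
    | zero => exact fun v => Iff.trans (by simp) (h₀ (by omega) v)
    | succ i => exact h i (by omega)

theorem isNPresented_of_ker_fg (n : ℕ) (M : Type u) [AddCommGroup M] [Module R M]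
    (r : ℕ → ℕ) (d : ∀ i : ℕ, (Fin (r (i + 1)) → R) →ₗ[R] (Fin (r i) → R))
    (ε : (Fin (r 0) → R) →ₗ[R] M) (hε : Function.Surjective ε) (h₀ : Function.Exact (d 0) ε)
    (h : ∀ i < n, Function.Exact (d (i + 1)) (d i)) (hfg : (LinearMap.ker (d n)).FG) :
    IsNPresented R (n + 2) M := by
  induction n generalizing M r with
  | zero =>
    have : Module.Finite R (LinearMap.ker (d 0)) := Module.Finite.iff_fg.2 hfg
    obtain ⟨p, f, hf⟩ := Module.Finite.exists_fin' R (LinearMap.ker (d 0))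
    -- Everything past `F_2` is padding: exactness is only required at `N`'s cover `F_0` and at
    -- `F_1`.
    refine ⟨fun | 0 => r 0 | 1 => r 1 | _ + 2 => p,
      fun | 0 => d 0 | 1 => (LinearMap.ker (d 0)).subtype ∘ₗ f | _ + 2 => 0,
      ε, hε, fun _ => h₀, fun i hi => ?_⟩
    obtain rfl : i = 0 := by omega
    intro v
    constructor
    · intro hv
      obtain ⟨w, hw⟩ := hf ⟨v, hv⟩
      exact ⟨w, congrArg Subtype.val hw⟩
    · rintro ⟨w, rfl⟩
      exact (f w).2
  | succ n ih =>
    refine isNPresented_succ_of_ker ε hε (ih (LinearMap.ker ε) (fun i => r (i + 1))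
      (fun i => d (i + 1)) ((d 0).codRestrict _ h₀.apply_apply_eq_zero) ?_ ?_
      (fun i hi => h (i + 1) (by omega)) hfg)
    · rintro ⟨v, hv⟩
      obtain ⟨w, rfl⟩ := (h₀ v).1 hv
      exact ⟨w, rfl⟩
    · intro v
      exact Subtype.ext_iff.trans (h 0 (by omega) v)

theorem sum_mul_map_single {m s : ℕ} (d : (Fin m → R) →ₗ[R] (Fin s → R)) (v : Fin m → R)
    (j : Fin s) : ∑ i, v i * d (Pi.single i 1) j = d v j := by
  conv_rhs => rw [pi_eq_sum_univ' v]
  simp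

theorem solutionsGenerated_self {m s : ℕ} (d : (Fin m → R) →ₗ[R] (Fin s → R)) :
    SolutionsGenerated (ModuleCat.of Rᵐᵒᵖ R) d := fun x hx =>
  ⟨1, fun _ => (1 : R), fun _ => x,
    fun _ => funext fun j => (sum_mul_map_single d x j).symm.trans (hx j),
    fun i => by
      rw [Finset.univ_unique, Finset.sum_singleton]
      exact (one_mul _).symm⟩

/-- The kernel of `d` is finitely generated as soon as the power of `R` indexed by it has a
preenvelope in a class containing `R` whose members satisfy `SolutionsGenerated _ d`. -/
theorem ker_fg_of_preenvelope {m s : ℕ} (d : (Fin m → R) →ₗ[R] (Fin s → R))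
    (ℱ : ObjectProperty (ModuleCat.{u} Rᵐᵒᵖ)) (hR : ℱ (ModuleCat.of Rᵐᵒᵖ R))
    (hℱ : ∀ F, ℱ F → SolutionsGenerated F d)
    (h : HasPreenvelope ℱ (ModuleCat.of Rᵐᵒᵖ (LinearMap.ker d → R))) :
    (LinearMap.ker d).FG := by
  obtain ⟨F, φ, hF, hφ⟩ := h
  choose f hf using fun a : LinearMap.ker d =>
    hφ (ModuleCat.of Rᵐᵒᵖ R) (ModuleCat.ofHom (LinearMap.proj a)) hR
  -- The tautological solution: its value at `a` is the vector `a` itself.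
  let x : Fin m → (LinearMap.ker d → R) := fun i a => a.1 i
  obtain ⟨k, y, l, hl, hx⟩ := hℱ F hF (fun i => φ.hom (x i)) fun j => by
    have : ∑ i, MulOpposite.op (d (Pi.single i 1) j) • x i = 0 := by
      ext a
      rw [Finset.sum_apply]
      exact (sum_mul_map_single d a.1 j).trans (congrFun a.2 j)
    rw [← map_zero φ.hom, ← this, map_sum]
    exact Finset.sum_congr rfl fun i _ => (map_smul φ.hom _ _).symm
  refine (Submodule.fg_def).2 ⟨Set.range l, Set.finite_range l, le_antisymm ?_ fun a ha => ?_⟩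
  · refine Submodule.span_le.2 ?_
    rintro _ ⟨b, rfl⟩
    exact hl b
  -- Applying the factorization `f` of the `a`-th projection to the expression of `φ x` recovers `a`
  -- as a combination of the `l b`.
  · let c : Fin k → R := fun b => (f ⟨a, ha⟩).hom (y b)
    have : a = ∑ b, c b • l b := by
      ext i
      have e : a i = (f ⟨a, ha⟩).hom (φ.hom (x i)) :=
        congrArg (fun g : ModuleCat.of Rᵐᵒᵖ (LinearMap.ker d → R) ⟶ ModuleCat.of Rᵐᵒᵖ R =>
          g.hom (x i)) (hf ⟨a, ha⟩)
      rw [e, hx i, map_sum, Finset.sum_apply]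
      exact Finset.sum_congr rfl fun b _ => map_smul (f ⟨a, ha⟩).hom _ _
    rw [this]
    exact Submodule.sum_mem _ fun b _ => Submodule.smul_mem _ _ (Submodule.subset_span ⟨b, rfl⟩)

end Coherence

/-! ### Preenvelopes for classes defined by linear systems. -/

section Systems

variable (S : Type u) [Ring S]

/-- A finite homogeneous linear system `∑ i, mat i j • x i = 0`, together with a finite list of
coefficient vectors `gen k`. -/
structure LinearSystem where
  vars : ℕ
  eqs : ℕ
  gens : ℕ
  mat : Fin vars → Fin eqs → S
  gen : Fin gens → Fin vars → S

variable {S}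

/-- Every solution of the system in `M` is a combination of the vectors `gen k`, with coefficients
in `M`. -/
def LinearSystem.SolvedIn (A : LinearSystem S) (M : Type u) [AddCommGroup M] [Module S M] : Prop :=
  ∀ x : Fin A.vars → M, (∀ j, ∑ i, A.mat i j • x i = 0) →
    ∃ y : Fin A.gens → M, ∀ i, x i = ∑ k, A.gen k i • y k

theorem LinearSystem.SolvedIn.pi {A : LinearSystem S} {J : Type u} {M : J → Type u}
    [∀ q, AddCommGroup (M q)] [∀ q, Module S (M q)] (h : ∀ q, A.SolvedIn (M q)) :
    A.SolvedIn (∀ q, M q) := by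
  intro x hx
  choose y hy using fun q => h q (fun i => x i q) fun j => by
    simpa using congrFun (hx j) q
  refine ⟨fun k q => y q k, fun i => funext fun q => ?_⟩
  simpa using hy q i

theorem LinearSystem.SolvedIn.of_equiv {A : LinearSystem S} {M N : Type u} [AddCommGroup M]
    [Module S M] [AddCommGroup N] [Module S N] (e : M ≃ₗ[S] N) (h : A.SolvedIn N) :
    A.SolvedIn M := by
  intro x hx
  obtain ⟨y, hy⟩ := h (fun i => e (x i)) fun j => by
    simpa using congrArg e (hx j)
  refine ⟨fun k => e.symm (y k), fun i => e.injective ?_⟩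
  simpa using hy i

/-- Formal terms built from `M` by the module operations and solution operations for the systems
`A i`. -/
inductive Term {I : Type u} (A : I → LinearSystem S) (M : Type u) : Type u
  | of (a : M) : Term A M
  | zero : Term A M
  | add (t t' : Term A M) : Term A M
  | smul (c : S) (t : Term A M) : Term A M
  | sol (i : I) (x : Fin (A i).vars → Term A M) (k : Fin (A i).gens) : Term A M

section Interpretation

variable {I : Type u} {A : I → LinearSystem S} {M N : Type u} [AddCommGroup N] [Module S N]

open Classical in
/-- The interpretation of terms in a module in which the systems are solved. -/
noncomputable def Term.eval (h : ∀ i, (A i).SolvedIn N) (f : M → N) : Term A M → N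
  | of a => f a
  | zero => 0
  | add t t' => t.eval h f + t'.eval h f
  | smul c t => c • t.eval h f
  | sol i x k =>
    -- The value `0` on arguments that do not solve the system makes evaluation total.
    if hx : ∀ j, ∑ l, (A i).mat l j • (x l).eval h f = 0 then (h i _ hx).choose k else 0

/-- The submodule of the values of terms. -/
noncomputable def Term.range (h : ∀ i, (A i).SolvedIn N) (f : M → N) : Submodule S N where
  carrier := Set.range (Term.eval h f)
  zero_mem' := ⟨zero, rfl⟩
  add_mem' := by
    rintro _ _ ⟨t, rfl⟩ ⟨t', rfl⟩
    exact ⟨add t t', rfl⟩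
  smul_mem' := by
    rintro c _ ⟨t, rfl⟩
    exact ⟨smul c t, rfl⟩

/-- If the entries of a solution are values of terms, so are the chosen coefficients, by the
constructor `sol`. -/
theorem Term.solvedIn_range (h : ∀ i, (A i).SolvedIn N) (f : M → N) (i : I) :
    (A i).SolvedIn (Term.range h f) := by
  intro x hx
  choose t ht using fun l => (x l).2
  have hx' : ∀ j, ∑ l, (A i).mat l j • (t l).eval h f = 0 := fun j => by
    simpa [ht] using congrArg Subtype.val (hx j)
  have e (k) : (sol i t k).eval h f = (h i _ hx').choose k := by
    rw [eval, dif_pos hx']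
  refine ⟨fun k => ⟨_, sol i t k, rfl⟩, fun l => Subtype.ext ?_⟩
  simpa [ht, e] using (h i _ hx').choose_spec l

end Interpretation

/-- A module structure on a quotient of the set of terms in which the systems are solved,
together with a homomorphism from `M`. -/
structure TermQuotient {I : Type u} (A : I → LinearSystem S) (M : Type u) [AddCommGroup M]
    [Module S M] : Type u where
  rel : Setoid (Term A M)
  [addCommGroup : AddCommGroup (Quotient rel)]
  [module : Module S (Quotient rel)]
  hom : M →ₗ[S] Quotient rel
  solved : ∀ i, (A i).SolvedIn (Quotient rel)

attribute [instance] TermQuotient.addCommGroup TermQuotient.module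

/-- This is the solution set condition: transporting `Term.range` to a quotient of the set of terms
gives an intermediate module from a `Type u` family independent of `N`. -/
theorem TermQuotient.exists_factor {I : Type u} {A : I → LinearSystem S} {M N : Type u}
    [AddCommGroup M] [Module S M] [AddCommGroup N] [Module S N] (h : ∀ i, (A i).SolvedIn N)
    (f : M →ₗ[S] N) :
    ∃ (q : TermQuotient A M) (g : Quotient q.rel →ₗ[S] N), g ∘ₗ q.hom = f := by
  let ev : Term A M → Term.range h f := fun t => ⟨t.eval h f, t, rfl⟩
  have hev : Function.Surjective ev := by
    rintro ⟨_, t, rfl⟩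
    exact ⟨t, rfl⟩
  let e : Quotient (Setoid.ker ev) ≃ Term.range h f := Setoid.quotientKerEquivOfSurjective ev hev
  let _ : AddCommGroup (Quotient (Setoid.ker ev)) := e.addCommGroup
  let _ : Module S (Quotient (Setoid.ker ev)) := e.module S
  let E : Quotient (Setoid.ker ev) ≃ₗ[S] Term.range h f := e.linearEquiv S
  let f' : M →ₗ[S] Term.range h f := f.codRestrict _ fun a => ⟨Term.of a, rfl⟩
  refine ⟨⟨Setoid.ker ev, E.symm.toLinearMap ∘ₗ f', fun i =>
    (Term.solvedIn_range h f i).of_equiv E⟩, (Term.range h f).subtype ∘ₗ E.toLinearMap, ?_⟩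
  ext a
  exact congrArg Subtype.val (E.apply_symm_apply (f' a))

theorem hasPreenvelope_of_solvedIn {I : Type u} (A : I → LinearSystem S) (M : ModuleCat.{u} S) :
    HasPreenvelope (fun F => ∀ i, (A i).SolvedIn F) M := by
  refine ⟨ModuleCat.of S (∀ q : TermQuotient A M, Quotient q.rel),
    ModuleCat.ofHom (LinearMap.pi fun q => q.hom),
    fun i => LinearSystem.SolvedIn.pi fun q => q.solved i, fun F f hF => ?_⟩
  obtain ⟨q, g, hg⟩ := TermQuotient.exists_factor hF f.hom
  refine ⟨ModuleCat.ofHom (g ∘ₗ LinearMap.proj q), ?_⟩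
  ext a
  exact (LinearMap.congr_fun hg a).symm

end Systems

/-! ### Coherence and relative flatness. -/

section Main

variable {R : Type u} [Ring R]

/-- The linear system over `Rᵐᵒᵖ` given by the matrix of `d` and the columns of `g`. -/
def systemOfExact {p m s : ℕ} (g : (Fin p → R) →ₗ[R] (Fin m → R))
    (d : (Fin m → R) →ₗ[R] (Fin s → R)) : LinearSystem Rᵐᵒᵖ where
  vars := m
  eqs := s
  gens := p
  mat i j := MulOpposite.op (d (Pi.single i 1) j)
  gen k i := MulOpposite.op (g (Pi.single k 1) i)

/-- By exactness each solution in `R` is a combination of the columns of `g`; regrouping replaces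
solutions that vary with `x` by these fixed columns. -/
theorem solvedIn_systemOfExact_iff {p m s : ℕ} (g : (Fin p → R) →ₗ[R] (Fin m → R))
    (d : (Fin m → R) →ₗ[R] (Fin s → R)) (h : Function.Exact g d) (M : ModuleCat.{u} Rᵐᵒᵖ) :
    (systemOfExact g d).SolvedIn M ↔ SolutionsGenerated M d := by
  constructor
  · intro H x hx
    obtain ⟨y, hy⟩ := H x hx
    exact ⟨p, y, fun k => g (Pi.single k 1), fun k => h.apply_apply_eq_zero _, hy⟩
  · intro H x hx
    obtain ⟨t, y, l, hl, hx⟩ := H x hx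
    choose c hc using fun a => (h (l a)).1 (hl a)
    have e (a : Fin t) (i : Fin m) : MulOpposite.op (l a i) • y a =
        ∑ k, MulOpposite.op (g (Pi.single k 1) i) • MulOpposite.op (c a k) • y a := by
      rw [← hc a, ← sum_mul_map_single g (c a) i, Finset.op_sum, Finset.sum_smul]
      exact Finset.sum_congr rfl fun k _ => by rw [MulOpposite.op_mul, mul_smul]
    refine ⟨fun k => ∑ a, MulOpposite.op (c a k) • y a, fun (i : Fin m) => ?_⟩
    rw [hx i]
    simp only [e]
    rw [Finset.sum_comm]
    exact Finset.sum_congr rfl fun k _ => Finset.smul_sum.symm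

theorem isLeftCoherent_of_hasPreenvelope (n : ℕ) (𝒳 : ObjectProperty (ModuleCat.{u} R))
    (h𝒳 : ∃ N, nPresentedPart 𝒳 (n + 1) N)
    (h : ∀ M : ModuleCat.{u} Rᵐᵒᵖ, HasPreenvelope (IsFlatRel (n + 1) 𝒳) M) :
    IsLeftCoherent (n + 1) 𝒳 := by
  refine ⟨h𝒳, fun N hN => ?_⟩
  obtain ⟨r, d, ε, hε, h₀, hd⟩ := hN.2
  have hd' : ∀ i < n, Function.Exact (d (i + 1)) (d i) := fun i hi => hd i (by omega)
  refine isNPresented_of_ker_fg n N r d ε hε (h₀ n.succ_pos) hd'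
    (ker_fg_of_preenvelope (d n) (IsFlatRel (n + 1) 𝒳) ?_ (fun F hF => ?_) (h _))
  · rintro N' ⟨-, r', d', ε', hε', h₀', hd''⟩
    exact (isZero_torGroup_succ_iff _ n N' r' d' ε' hε' (h₀' n.succ_pos)
      fun i hi => hd'' i (by omega)).2 (solutionsGenerated_self _)
  · exact (isZero_torGroup_succ_iff F n N r d ε hε (h₀ n.succ_pos) hd').1 (hF N hN)

/-- Over a left `(n + 1)`-`𝒳`-coherent ring, relative flatness amounts to the solvability of a set
of linear systems. -/
theorem IsLeftCoherent.exists_systems {n : ℕ} {𝒳 : ObjectProperty (ModuleCat.{u} R)}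
    (h : IsLeftCoherent (n + 1) 𝒳) :
    ∃ (I : Type u) (A : I → LinearSystem Rᵐᵒᵖ),
      IsFlatRel (n + 1) 𝒳 = fun M : ModuleCat.{u} Rᵐᵒᵖ => ∀ i, (A i).SolvedIn M := by
  -- Modules in the class live one universe too high to serve as indices, whereas finite systems
  -- over `Rᵐᵒᵖ` form a type in `Type u`; hence all systems solved in every relatively flat module
  -- are taken.
  let T : Set (LinearSystem Rᵐᵒᵖ) :=
    {A | ∀ M : ModuleCat.{u} Rᵐᵒᵖ, IsFlatRel (n + 1) 𝒳 M → A.SolvedIn M}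
  refine ⟨T, Subtype.val, funext fun M => propext ⟨fun hM A => A.2 M hM, fun hM N hN => ?_⟩⟩
  obtain ⟨r, d, ε, hε, h₀, hd⟩ := h.2 N hN
  have tor (F) := isZero_torGroup_succ_iff F n N r d ε hε (h₀ (by omega))
    fun i hi => hd i (by omega)
  have solved (F) := solvedIn_systemOfExact_iff (d (n + 1)) (d n) (hd n (by omega)) F
  exact (tor M).2 ((solved M).1 (hM ⟨systemOfExact (d (n + 1)) (d n), fun F hF =>
    (solved F).2 ((tor F).1 (hF N hN))⟩))

end Main

end RelCoherent

theorem mainTheorem3 (R : Type u) [Ring R] (n : ℕ) (hn : 1 ≤ n)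
    (𝒳 : ObjectProperty (ModuleCat.{u} R))
    (h𝒳 : ∃ N : ModuleCat.{u} R, RelCoherent.nPresentedPart 𝒳 n N) :
    RelCoherent.IsLeftCoherent n 𝒳 ↔
      ∀ M : ModuleCat.{u} Rᵐᵒᵖ,
        RelCoherent.HasPreenvelope (RelCoherent.IsFlatRel n 𝒳) M := by
  obtain ⟨n, rfl⟩ := Nat.exists_eq_add_of_le' hn
  constructor
  · intro h M
    obtain ⟨I, A, hA⟩ := h.exists_systems
    rw [hA]
    exact RelCoherent.hasPreenvelope_of_solvedIn A M
  · exact RelCoherent.isLeftCoherent_of_hasPreenvelope n 𝒳 h𝒳
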